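/- Let $\Sigma$ be a finite set of real $n\times n$ matrices. For $\Sigma'\subseteq\Sigma$ put $N_{\Sigma'}=\bigcap_{B\in\Sigma'}\ker(I-B)$ and $R_{\Sigma'}=\operatorname{span}\bigcup_{B\in\Sigma'}\operatorname{range}(I-B)$. Suppose that $\Sigma$ is a CP set, that is: - (LCP) for every sequence $A_1,A_2,\dots$ in $\Sigma$ the products $A_m\cdots A_1$ converge as $m\to\infty$; - (RCP) for every such sequence the products $A_1\cdots A_m$ converge as $m\to\infty$; - (transversality) $\mathbb R^n=N_{\Sigma'}\oplus R_{\Sigma'}$ for every $\Sigma'\subseteq\Sigma$. Let $R$ be a linearly ordered set and $A:R\to\Sigma$ a map. For $S\subseteq R$ the product $M(S)=\prod_{r\in S}A(r)$ is defined by recursion on the cardinality of the set of values $A(S)$, as follows. An interval of $S$ is a subset $T\subseteq S$ such that $a,b\in T$, $g\in S$, $a<g<b$ imply $g\in T$; it is called complete if $A(T)=A(S)$ and incomplete otherwise. - If $S=\{s_1<\dots<s_k\}$ is finite, then $M(S)=A(s_1)\cdots A(s_k)$ (and $M(\emptyset)=I$). - If $S$ is infinite and contains arbitrarily many pairwise disjoint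 complete intervals, then $M(S)$ is the projection onto $N_{A(S)}$ along $R_{A(S)}$. - If $S$ is infinite and the number of pairwise disjoint complete intervals of $S$ is bounded, then $M(S)=M(T_1)\cdots M(T_m)$, where $T_1<\dots<T_m$ is a partition of $S$ into finitely many disjoint incomplete intervals (such a partition exists, and the product does not depend on its choice). Then each of the four matrix-valued functions $$r\mapsto M(\{p\in R:p\le r\}),\quad r\mapsto M(\{p\in R:p<r\}),\quad r\mapsto M(\{p\in R:p\ge r\}),\quad r\mapsto M(\{p\in R:p>r\})$$ has bounded variation on $R$: for each of them, call it $f$, the sums $\sum_{i=1}^{m-1}\|f(r_{i+1})-f(r_i)\|$ over all finite chains $r_1\le\dots\le r_m$ in $R$ are bounded. -/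

import Mathlib

open Filter Topology

/-! ### LCP, RCP and transversal sets of matrices -/

/-- The product `s (m-1) * ... * s 1 * s 0`: every new factor is put on the left. -/
def leftProd {n : ℕ} (s : ℕ → Matrix (Fin n) (Fin n) ℝ) : ℕ → Matrix (Fin n) (Fin n) ℝ
  | 0 => 1
  | m + 1 => s m * leftProd s m

/-- The product `s 0 * s 1 * ... * s (m-1)`: every new factor is put on the right. -/
def rightProd {n : ℕ} (s : ℕ → Matrix (Fin n) (Fin n) ℝ) : ℕ → Matrix (Fin n) (Fin n) ℝ
  | 0 => 1
  | m + 1 => rightProd s m * s m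

/-- Left convergent products: for every sequence in `Sig` the left products converge. -/
def IsLCP {n : ℕ} (Sig : Set (Matrix (Fin n) (Fin n) ℝ)) : Prop :=
  ∀ s : ℕ → Matrix (Fin n) (Fin n) ℝ, (∀ i, s i ∈ Sig) →
    ∃ L : Matrix (Fin n) (Fin n) ℝ, Tendsto (leftProd s) atTop (𝓝 L)

/-- Right convergent products: for every sequence in `Sig` the right products converge. -/
def IsRCP {n : ℕ} (Sig : Set (Matrix (Fin n) (Fin n) ℝ)) : Prop :=
  ∀ s : ℕ → Matrix (Fin n) (Fin n) ℝ, (∀ i, s i ∈ Sig) →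
    ∃ L : Matrix (Fin n) (Fin n) ℝ, Tendsto (rightProd s) atTop (𝓝 L)

/-- `N_T`, the intersection of the null spaces of `1 - B`, `B ∈ T`. -/
noncomputable def commonKer {n : ℕ} (T : Set (Matrix (Fin n) (Fin n) ℝ)) :
    Submodule ℝ (Fin n → ℝ) :=
  ⨅ B ∈ T, LinearMap.ker (Matrix.toLin' (1 - B))

/-- `R_T`, the span of the ranges of `1 - B`, `B ∈ T`. -/
noncomputable def rangeSpan {n : ℕ} (T : Set (Matrix (Fin n) (Fin n) ℝ)) :
    Submodule ℝ (Fin n → ℝ) :=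
  ⨆ B ∈ T, LinearMap.range (Matrix.toLin' (1 - B))

/-- `ℝⁿ` is the direct sum of `N_T` and `R_T` for every subset `T` of `Sig`. -/
def IsTransversal {n : ℕ} (Sig : Set (Matrix (Fin n) (Fin n) ℝ)) : Prop :=
  ∀ T ⊆ Sig, IsCompl (commonKer T) (rangeSpan T)

/-- A CP set: LCP, RCP and transversal. -/
structure IsCP {n : ℕ} (Sig : Set (Matrix (Fin n) (Fin n) ℝ)) : Prop where
  lcp : IsLCP Sig
  rcp : IsRCP Sig
  transversal : IsTransversal Sig

/-- The matrix of the projection onto `N_T` along `R_T`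
(with the value `0` when these subspaces are not complementary). -/
noncomputable def projMatrix {n : ℕ} (T : Set (Matrix (Fin n) (Fin n) ℝ)) :
    Matrix (Fin n) (Fin n) ℝ :=
  open Classical in
  if h : IsCompl (commonKer T) (rangeSpan T) then LinearMap.toMatrix' (Submodule.projection _ _ h) else 0

/-! ### Products over subsets of a linearly ordered set -/

/-- `T` is an interval of the ordered set `S`: a subset of `S` without holes. -/
def IsIntervalOf {R : Type*} [LinearOrder R] (S T : Set R) : Prop :=
  T ⊆ S ∧ ∀ a ∈ T, ∀ b ∈ T, ∀ g ∈ S, a < g → g < b → g ∈ T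

/-- `I_S(A)`, the maximal number (possibly `⊤`) of pairwise disjoint intervals `T` of `S` that are
complete, which means that `A` takes on `T` all the values that it takes on `S`. -/
noncomputable def completeCount {n : ℕ} {R : Type*} [LinearOrder R]
    (A : R → Matrix (Fin n) (Fin n) ℝ) (S : Set R) : ℕ∞ :=
  sSup {c : ℕ∞ | ∃ (m : ℕ) (T : Fin m → Set R), c = m ∧
    (∀ i, IsIntervalOf S (T i) ∧ A '' T i = A '' S) ∧ ∀ i j, i ≠ j → Disjoint (T i) (T j)}

/-- The list `l` is a partition of `S` into adjacent disjoint incomplete intervals, listed in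
increasing order. -/
structure IsIncompletePartition {n : ℕ} {R : Type*} [LinearOrder R]
    (A : R → Matrix (Fin n) (Fin n) ℝ) (S : Set R) (l : List (Set R)) : Prop where
  interval : ∀ T ∈ l, IsIntervalOf S T
  incomplete : ∀ T ∈ l, A '' T ≠ A '' S
  increasing : l.Pairwise fun T T' => ∀ a ∈ T, ∀ b ∈ T', a < b
  cover : ∀ x ∈ S, ∃ T ∈ l, x ∈ T

/-- `M(S)`, the product of the matrices `A r` over `r ∈ S` in increasing order of `r`, for a map `A`
with finitely many values, by recursion on the number of values of `A` on `S`.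
* If `S` is finite, it is the usual ordered product.
* If there are arbitrarily many disjoint complete intervals, it is the projection `P_J`, where `J`
  is the set of values of `A` on `S`.
* Otherwise it is the product of the `M(T)` over the members `T`, in increasing order, of a
  partition of `S` into finitely many incomplete intervals.

"Complete" always refers here to the set of values of `A` on `S` itself: for a larger set of
matrices, `S` is incomplete, hence one single piece of such a partition, and `M(S)` is the product
that is already defined. The last value `1` is never used when `A` has finitely many values. -/
noncomputable def contProd {n : ℕ} {R : Type*} [LinearOrder R]
    (A : R → Matrix (Fin n) (Fin n) ℝ) (S : Set R) : Matrix (Fin n) (Fin n) ℝ :=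
  open Classical in
  if hS : S.Finite then ((hS.toFinset.sort (· ≤ ·)).map A).prod
  else if completeCount A S = ⊤ then projMatrix (A '' S)
  else if h : (A '' S).Finite ∧ ∃ l, IsIncompletePartition A S l then
    (h.2.choose.attach.map fun T => contProd A T.1).prod
  else 1
termination_by (A '' S).ncard
decreasing_by
  exact Set.ncard_lt_ncard
    (lt_of_le_of_ne (Set.image_mono (h.2.choose_spec.interval T.1 T.2).1)
      (h.2.choose_spec.incomplete T.1 T.2)) h.1

/-! The norm used to measure the variation of a matrix-valued function: the maximal absolute row
sum, which is the operator norm for the sup norm on `ℝⁿ`. -/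

attribute [local instance] Matrix.linftyOpNormedAddCommGroup

/-! `M(S)` is the limit of the ordinary ordered products over `F ∩ S`, where `F` runs through the
directed family of finite subsets of `R` (`tendsto_prod_partialWord`). Any bound on variation sums
that is uniform in `F` therefore passes to `M`, and it suffices to bound the total variation of the
partial products of a finite word over `Sig`, independently of the word
(`RightConvergent.exists_prodVariation_le`). For initial segments of `R` the words grow on the right
and RCP is used; for final segments they grow on the left, and LCP gives the same bound in the
opposite ring.

The bound for words rests on two uniform facts, both proved by pasting bad finite words into one
infinite word that contradicts convergence: all word products are bounded, and a word with many
disjoint complete blocks (each containing every letter of `J`) has product close to the projection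
`P` of `J`. Then induct on the set of letters. A word splits into minimal complete blocks and an
incomplete rest, whose variations are controlled by smaller letter sets. Starting from `1 - P`
instead of `1` changes no increment, and every `k` blocks halve the norm of a start annihilated by
`P`, so the variation is dominated by a geometric series.

The limit formula is proved by induction on the number of values of `A` on `S`. With arbitrarily
many complete intervals, finitely many points already carry many blocks, which forces the product
near `P`. Otherwise a greedy cutting (`exists_isAvoidingPartition`) yields finitely many incomplete
pieces. -/

/-- Finite words that can be extended again and again by nonempty words are the prefixes of an
infinite word. -/
theorem exists_infinite_word {α : Type*} (T : List α → Prop) (G : ℕ → List α → Prop)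
    (h0 : G 0 []) (hs : ∀ i W, G i W → ∃ b, b ≠ [] ∧ T b ∧ G (i + 1) (W ++ b)) :
    ∃ (s : ℕ → α) (W b : ℕ → List α), (∀ i, G i (W i)) ∧ (∀ i, T (b i)) ∧
      (∀ i, i ≤ (W i).length) ∧ (∀ i, W i = (List.range (W i).length).map s) ∧
      (∀ m, ∃ i, s m ∈ b i) ∧ ∀ i, ∀ c ∈ b i, ∃ m ≥ i, s m = c := by
  choose! ext hne hT hG using hs
  let W : ℕ → List α := fun i => Nat.rec [] (fun i W => W ++ ext i W) i
  have hW : ∀ i, W (i + 1) = W i ++ ext i (W i) := fun i => rfl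
  have hGW : ∀ i, G i (W i) := fun i => by
    induction i with
    | zero => exact h0
    | succ i ih => exact hG i _ ih
  have hlen : ∀ i, i ≤ (W i).length := fun i => by
    induction i with
    | zero => simp
    | succ i ih =>
      have := List.length_pos_iff.2 (hne i _ (hGW i))
      rw [hW, List.length_append]; omega
  have hpre : ∀ i j, i ≤ j → W i <+: W j := fun i j hij => by
    induction j, hij using Nat.le_induction with
    | base => exact List.prefix_rfl
    | succ j _ ih => exact ih.trans (hW j ▸ List.prefix_append _ _)
  -- Extensions are nonempty, so position `m` is already filled at stage `m + 1`.
  have hlt : ∀ m, m < (W (m + 1)).length := fun m => hlen (m + 1)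
  let s : ℕ → α := fun m => (W (m + 1))[m]'(hlt m)
  have hget : ∀ i m (h : m < (W i).length), (W i)[m] = s m := fun i m h => by
    rcases le_total i (m + 1) with h1 | h1
    · exact (hpre _ _ h1).getElem h
    · exact ((hpre _ _ h1).getElem (hlt m)).symm
  have hmem : ∀ i, ∀ c ∈ W i, ∃ j, c ∈ ext j (W j) := fun i => by
    induction i with
    | zero => intro c hc; simp [W] at hc
    | succ i ih =>
      intro c hc
      rw [hW, List.mem_append] at hc
      exact hc.elim (ih c) fun h => ⟨i, h⟩
  refine ⟨s, W, fun i => ext i (W i), hGW, fun i => hT i _ (hGW i), hlen, fun i => ?_, fun m => ?_,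
    fun i c hc => ?_⟩
  · apply List.ext_getElem (by simp)
    intro m h1 h2
    simp [hget i m h1]
  · exact hmem (m + 1) _ (List.getElem_mem _)
  · obtain ⟨j, hj, rfl⟩ := List.getElem_of_mem hc
    refine ⟨(W i).length + j, (hlen i).trans (Nat.le_add_right _ _), ?_⟩
    have hj2 : j < (ext i (W i)).length := hj
    have hj' : (W i).length + j < (W (i + 1)).length := by
      rw [hW, List.length_append]; omega
    rw [← hget (i + 1) _ hj']
    simp [hW]

/-! ### Right convergent sets: boundedness, approach to projections, bounded variation. -/

section NormedRing

variable {𝔸 : Type*} [NormedRing 𝔸]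

/-- For every sequence in `Sig` the products, with new factors on the right, converge. -/
def RightConvergent (Sig : Finset 𝔸) : Prop :=
  ∀ s : ℕ → 𝔸, (∀ i, s i ∈ Sig) →
    ∃ L, Tendsto (fun m => ((List.range m).map s).prod) atTop (𝓝 L)

/-- `P` is fixed by multiplication with elements of `J` from either side, and every `X` that is
fixed by right multiplication with all elements of `J` is fixed by right multiplication with `P`. -/
structure IsFixProj (J : Set 𝔸) (P : 𝔸) : Prop where
  mul_left : ∀ B ∈ J, B * P = P
  mul_right : ∀ B ∈ J, P * B = P
  fix : ∀ X : 𝔸, (∀ B ∈ J, X * B = X) → X * P = X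

theorem IsFixProj.prod_mul {J : Set 𝔸} {P : 𝔸} (h : IsFixProj J P) {l : List 𝔸}
    (hl : ∀ B ∈ l, B ∈ J) : l.prod * P = P := by
  induction l with
  | nil => simp
  | cons b l ih =>
    rw [List.prod_cons, mul_assoc, ih fun B hB => hl B (by simp [hB]), h.mul_left b (hl b (by simp))]

theorem IsFixProj.mul_prod {J : Set 𝔸} {P : 𝔸} (h : IsFixProj J P) {l : List 𝔸}
    (hl : ∀ B ∈ l, B ∈ J) : P * l.prod = P := by
  induction l with
  | nil => simp
  | cons b l ih =>
    rw [List.prod_cons, ← mul_assoc, h.mul_right b (hl b (by simp)), ih fun B hB => hl B (by simp [hB])]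

theorem IsFixProj.mul_self {J : Set 𝔸} {P : 𝔸} (h : IsFixProj J P) : P * P = P :=
  h.fix P h.mul_right

/-- Products over words in a finite right convergent set are bounded. -/
theorem RightConvergent.exists_norm_prod_le [NormedAlgebra ℝ 𝔸] [FiniteDimensional ℝ 𝔸]
    {Sig : Finset 𝔸} (h : RightConvergent Sig) :
    ∃ K : ℝ, 0 < K ∧ ∀ l : List 𝔸, (∀ B ∈ l, B ∈ Sig) → ‖l.prod‖ ≤ K := by
  -- The subspace of elements with bounded orbit under right multiplication by words; the claim is
  -- that it contains `1`.
  let V : Submodule ℝ 𝔸 :=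
    { carrier := {X | ∃ C : ℝ, ∀ l : List 𝔸, (∀ B ∈ l, B ∈ Sig) → ‖X * l.prod‖ ≤ C}
      add_mem' := by
        rintro X Y ⟨C, hC⟩ ⟨D, hD⟩
        refine ⟨C + D, fun l hl => ?_⟩
        rw [add_mul]
        exact (norm_add_le _ _).trans (add_le_add (hC l hl) (hD l hl))
      zero_mem' := ⟨0, fun l _ => by simp⟩
      smul_mem' := by
        rintro c X ⟨C, hC⟩
        refine ⟨‖c‖ * C, fun l hl => ?_⟩
        rw [smul_mul_assoc, norm_smul]
        exact mul_le_mul_of_nonneg_left (hC l hl) (norm_nonneg _) }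
  by_cases h1 : (1 : 𝔸) ∈ V
  · obtain ⟨C, hC⟩ := h1
    exact ⟨max C 1, by positivity, fun l hl => by simpa using Or.inl (hC l hl)⟩
  exfalso
  -- Uniform boundedness turns the pointwise bounds on `V` into a single constant.
  obtain ⟨C, hC⟩ : ∃ C : ℝ, ∀ X ∈ V, ∀ l : List 𝔸, (∀ B ∈ l, B ∈ Sig) → ‖X * l.prod‖ ≤ C * ‖X‖ := by
    have : CompleteSpace V := FiniteDimensional.complete ℝ V
    obtain ⟨C, hC⟩ := banach_steinhaus (𝕜 := ℝ) (ι := {l : List 𝔸 // ∀ B ∈ l, B ∈ Sig})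
      (g := fun l => ((ContinuousLinearMap.mul ℝ 𝔸).flip l.1.prod).comp V.subtypeL)
      (fun X => by
        obtain ⟨C, hC⟩ := X.2
        exact ⟨C, fun l => by simpa using hC l.1 l.2⟩)
    refine ⟨C, fun X hX l hl => ?_⟩
    have := ContinuousLinearMap.le_of_opNorm_le _ (hC ⟨l, hl⟩) ⟨X, hX⟩
    simpa using this
  have hC0 : ∀ X ∈ V, ∀ l : List 𝔸, (∀ B ∈ l, B ∈ Sig) → ‖X * l.prod‖ ≤ |C| * ‖X‖ :=
    fun X hX l hl => (hC X hX l hl).trans (mul_le_mul_of_nonneg_right (le_abs_self C) (norm_nonneg _))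
  have hSg : ∀ B ∈ Sig, ‖B‖ ≤ ∑ B ∈ Sig, ‖B‖ := fun B hB =>
    Finset.single_le_sum (f := fun B => ‖B‖) (fun _ _ => norm_nonneg _) hB
  have hM0 : 0 ≤ ∑ B ∈ Sig, ‖B‖ := Finset.sum_nonneg fun _ _ => norm_nonneg _
  generalize ∑ B ∈ Sig, ‖B‖ = M at hSg hM0
  -- Outside `V` the product can be made large while staying outside `V`. Otherwise the orbit is
  -- below `N` until it enters `V`, below `N * M` on entry, and controlled by `C` afterwards, hence
  -- bounded.
  have step : ∀ X, X ∉ V → ∀ N : ℝ, 0 ≤ N → ∃ l : List 𝔸, (∀ B ∈ l, B ∈ Sig) ∧ X * l.prod ∉ V ∧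
      N ≤ ‖X * l.prod‖ := by
    intro X hX N hN
    by_contra! hcon
    refine hX ⟨N + |C| * (N * M), fun l hl => ?_⟩
    have key : ∀ l : List 𝔸, (∀ B ∈ l, B ∈ Sig) → X * l.prod ∈ V → ∃ Y ∈ V, ∃ l' : List 𝔸,
        (∀ B ∈ l', B ∈ Sig) ∧ ‖Y‖ ≤ N * M ∧ X * l.prod = Y * l'.prod := by
      intro l
      induction l using List.reverseRecOn with
      | nil => intro _ h; simp [hX] at h
      | append_singleton l b ih =>
        intro hl hv
        have hb : b ∈ Sig := hl b (by simp)
        have hl' : ∀ B ∈ l, B ∈ Sig := fun B hB => hl B (by simp [hB])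
        by_cases hw : X * l.prod ∈ V
        · obtain ⟨Y, hY, l', hl2, hn, he⟩ := ih hl' hw
          refine ⟨Y, hY, l' ++ [b], ?_, hn, ?_⟩
          · intro B hB
            rcases List.mem_append.1 hB with h | h
            · exact hl2 B h
            · rw [List.mem_singleton.1 h]; exact hb
          · simp [← mul_assoc, he]
        · refine ⟨_, hv, [], by simp, ?_, by simp⟩
          have := (hcon l hl' hw).le
          simp only [List.prod_append, List.prod_singleton, ← mul_assoc]
          exact (norm_mul_le _ _).trans (mul_le_mul this (hSg b hb) (norm_nonneg _) hN)
    by_cases hw : X * l.prod ∈ V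
    · obtain ⟨Y, hY, l', hl2, hn, he⟩ := key l hl hw
      rw [he]
      have h2 := (hC0 Y hY l' hl2).trans (mul_le_mul_of_nonneg_left hn (abs_nonneg C))
      linarith
    · have := hcon l hl hw
      have h2 : 0 ≤ |C| * (N * M) := by positivity
      linarith
  obtain ⟨s, W, b, hG, hT, hlen, hW, hs, -⟩ := exists_infinite_word
    (fun b : List 𝔸 => ∀ B ∈ b, B ∈ Sig) (fun i W => W.prod ∉ V ∧ (i : ℝ) ≤ ‖W.prod‖)
    (by simpa using h1)
    (fun i W hW => by
      -- The second term of the maximum forces the extension to be nonempty.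
      obtain ⟨l, hl, hlV, hlN⟩ := step W.prod hW.1 (max (i + 1) (‖W.prod‖ + 1)) (by positivity)
      refine ⟨l, ?_, hl, ?_, ?_⟩
      · rintro rfl
        have := (le_max_right _ _).trans hlN
        simp only [List.prod_nil, mul_one] at this
        linarith
      · rwa [List.prod_append]
      · rw [List.prod_append]
        push_cast
        exact (le_max_left _ _).trans hlN)
  obtain ⟨L, hL⟩ := h s fun m => by
    obtain ⟨i, hi⟩ := hs m
    exact hT i _ hi
  have htop : Tendsto (fun i => (W i).length) atTop atTop := tendsto_atTop_mono hlen tendsto_id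
  have h2 := (hL.comp htop).norm
  refine not_tendsto_nhds_of_tendsto_atTop ?_ _ h2
  refine tendsto_atTop_mono (fun i => ?_) tendsto_natCast_atTop_atTop
  simp only [Function.comp]
  rw [← hW i]
  exact (hG i).2

/-- A word in the letters `J` in which every letter occurs. -/
def IsCompleteWord {α : Type*} (J : Set α) (b : List α) : Prop :=
  (∀ B ∈ b, B ∈ J) ∧ ∀ B ∈ J, B ∈ b

theorem mem_of_mem_flatten {α : Type*} {J : Set α} {bs : List (List α)}
    (h : ∀ b ∈ bs, ∀ B ∈ b, B ∈ J) : ∀ B ∈ bs.flatten, B ∈ J := fun B hB => by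
  obtain ⟨b, hb, hB⟩ := List.mem_flatten.1 hB
  exact h b hb B hB

/-- Products over words with many complete blocks are uniformly close to the projection. -/
theorem RightConvergent.exists_norm_prod_sub_le [NormedAlgebra ℝ 𝔸] [FiniteDimensional ℝ 𝔸]
    {Sig : Finset 𝔸} (h : RightConvergent Sig) {J : Set 𝔸} (hJ : J ⊆ Sig) {P : 𝔸}
    (hP : IsFixProj J P) {ε : ℝ} (hε : 0 < ε) :
    ∃ k : ℕ, ∀ bs : List (List 𝔸), (∀ b ∈ bs, IsCompleteWord J b) → k ≤ bs.length →
      ‖bs.flatten.prod - P‖ ≤ ε := by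
  obtain ⟨K, hK0, hK⟩ := h.exists_norm_prod_le
  have : ProperSpace 𝔸 := FiniteDimensional.proper ℝ 𝔸
  have hKJ : ∀ l : List 𝔸, (∀ B ∈ l, B ∈ J) → ‖l.prod‖ ≤ K := fun l hl =>
    hK l fun B hB => hJ (hl B hB)
  by_contra! hcon
  -- Without letters complete blocks are empty and build no infinite word; here `P = 1`.
  obtain rfl | ⟨B₀, hB₀⟩ := J.eq_empty_or_nonempty
  · obtain ⟨bs, hbs, -, hlt⟩ := hcon 0
    have h1 : bs.flatten = [] := List.eq_nil_iff_forall_not_mem.2 fun B hB =>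
      mem_of_mem_flatten (fun b hb => (hbs b hb).1) B hB
    have h2 := hP.fix 1 (by simp)
    rw [one_mul] at h2
    rw [h1, h2] at hlt
    simp only [List.prod_nil, sub_self, norm_zero] at hlt
    linarith
  let Bad : 𝔸 → ℝ → Prop := fun X δ => ∀ k : ℕ, ∃ bs : List (List 𝔸),
    (∀ b ∈ bs, IsCompleteWord J b) ∧ k ≤ bs.length ∧ δ < ‖X * bs.flatten.prod‖
  -- Compactness: the first blocks depend on `k`, but their products with `X` accumulate, so one
  -- fixed block can replace infinitely many of them at the cost `δ - δ'`.
  have step : ∀ X δ δ', Bad X δ → δ' < δ → ∃ b, IsCompleteWord J b ∧ Bad (X * b.prod) δ' := by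
    intro X δ δ' hX hδ
    have h1 : ∀ k : ℕ, ∃ (b : List 𝔸) (t : List (List 𝔸)), IsCompleteWord J b ∧
        (∀ b ∈ t, IsCompleteWord J b) ∧ k ≤ t.length ∧ δ < ‖X * b.prod * t.flatten.prod‖ := by
      intro k
      obtain ⟨bs, hbs, hk, hlt⟩ := hX (k + 1)
      cases bs with
      | nil => simp at hk
      | cons b t =>
        refine ⟨b, t, hbs b (by simp), fun c hc => hbs c (by simp [hc]), by simpa using hk, ?_⟩
        simpa [mul_assoc] using hlt
    choose b t hb ht htk hlt using h1
    obtain ⟨y, -, φ, hφ, hy⟩ := tendsto_subseq_of_bounded (Metric.isBounded_closedBall (x := (0 : 𝔸))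
      (r := ‖X‖ * K)) (x := fun k => X * (b k).prod) (fun k => by
        rw [mem_closedBall_zero_iff]
        exact (norm_mul_le _ _).trans
          (mul_le_mul_of_nonneg_left (hKJ _ (hb k).1) (norm_nonneg _)))
    have hη : 0 < (δ - δ') / K := div_pos (sub_pos.2 hδ) hK0
    obtain ⟨N, hN⟩ := Metric.cauchySeq_iff'.1 hy.cauchySeq _ hη
    refine ⟨b (φ N), hb _, fun k => ⟨t (φ (max N k)), ht _, ?_, ?_⟩⟩
    · exact ((le_max_right N k).trans (hφ.le_apply)).trans (htk _)
    · have h2 := hN (max N k) (le_max_left _ _)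
      have h3 := hlt (φ (max N k))
      have h4 := hKJ _ (mem_of_mem_flatten fun b hb => (ht (φ (max N k)) b hb).1)
      simp only [Function.comp, dist_eq_norm] at h2
      generalize (t (φ (max N k))).flatten.prod = w at h3 h4
      generalize X * (b (φ (max N k))).prod = y₁ at h2 h3
      generalize X * (b (φ N)).prod = y₂ at h2
      have h5 : ‖(y₁ - y₂) * w‖ ≤ δ - δ' := by
        refine (norm_mul_le _ _).trans ?_
        calc ‖y₁ - y₂‖ * ‖w‖ ≤ (δ - δ') / K * K :=
              mul_le_mul h2.le h4 (norm_nonneg _) hη.le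
          _ = δ - δ' := by field_simp
      have h6 : ‖y₁ * w‖ ≤ ‖(y₁ - y₂) * w‖ + ‖y₂ * w‖ := by
        rw [sub_mul]
        simpa using norm_add_le (y₁ * w - y₂ * w) (y₂ * w)
      linarith
  have hQ : ∀ l : List 𝔸, (∀ B ∈ l, B ∈ J) → (1 - P) * l.prod = l.prod - P := fun l hl => by
    rw [sub_mul, one_mul, hP.mul_prod hl]
  obtain ⟨s, W, b, hG, hT, hlen, hW, hs, hoft⟩ := exists_infinite_word (IsCompleteWord J)
    -- The thresholds decrease strictly at each stage but stay above `ε / 2`.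
    (fun i W => (∀ B ∈ W, B ∈ J) ∧ Bad ((1 - P) * W.prod) (ε / 2 + ε / 2 * (1 / 2) ^ i))
    (by
      refine ⟨by simp, fun k => ?_⟩
      obtain ⟨bs, hbs, hk, hlt⟩ := hcon k
      refine ⟨bs, hbs, hk, ?_⟩
      simp only [List.prod_nil, mul_one, pow_zero]
      rw [hQ _ (mem_of_mem_flatten fun b hb => (hbs b hb).1)]
      linarith)
    (fun i W hW => by
      obtain ⟨b, hb, hbad⟩ := step _ _ (ε / 2 + ε / 2 * (1 / 2) ^ (i + 1)) hW.2 (by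
        rw [pow_succ]
        have : 0 < ε / 2 * (1 / 2) ^ i := by positivity
        linarith)
      refine ⟨b, List.ne_nil_of_mem (hb.2 _ hB₀), hb, ?_, ?_⟩
      · intro B hB
        exact (List.mem_append.1 hB).elim (hW.1 B) (hb.1 B)
      · rwa [List.prod_append, ← mul_assoc])
  have hsJ : ∀ m, s m ∈ J := fun m => by
    obtain ⟨i, hi⟩ := hs m
    exact (hT i).1 _ hi
  obtain ⟨L, hL⟩ := h s fun m => hJ (hsJ m)
  -- Each letter recurs infinitely often, so `L` is also the limit along the products that end in
  -- `B`.
  have hLfix : ∀ B ∈ J, L * B = L := by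
    intro B hB
    have hf : ∀ i, ∃ m ≥ i, s m = B := fun i => hoft i B ((hT i).2 B hB)
    choose ψ hψ hψB using hf
    have hψt : Tendsto ψ atTop atTop := tendsto_atTop_mono hψ tendsto_id
    refine tendsto_nhds_unique ((hL.comp hψt).mul_const B)
      ((hL.comp ((tendsto_add_atTop_nat 1).comp hψt)).congr fun i => ?_)
    simp [Function.comp, List.range_succ, hψB]
  have hLP : L * P = P := by
    refine tendsto_nhds_unique (hL.mul_const P) (tendsto_const_nhds.congr fun m => ?_)
    refine (hP.prod_mul fun B hB => ?_).symm
    obtain ⟨j, -, rfl⟩ := List.mem_map.1 hB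
    exact hsJ j
  -- `L * P` equals `L` because `J` fixes `L`, and equals `P` because every partial product fixes
  -- `P`.
  have hLeq : L = P := (hP.fix L hLfix).symm.trans hLP
  subst hLeq
  have htop : Tendsto (fun i => (W i).length) atTop atTop := tendsto_atTop_mono hlen tendsto_id
  have h2 := ((hL.comp htop).sub_const L).norm
  rw [sub_self, norm_zero] at h2
  obtain ⟨i, hi⟩ := (h2.eventually (gt_mem_nhds (show 0 < ε / 2 / K by positivity))).exists
  simp only [Function.comp] at hi
  rw [← hW i, ← hQ _ (hG i).1] at hi
  obtain ⟨bs, hbs, -, hlt⟩ := (hG i).2 0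
  have h3 := hKJ _ (mem_of_mem_flatten fun b hb => (hbs b hb).1)
  have h4 : ‖(1 - L) * (W i).prod * bs.flatten.prod‖ ≤ ε / 2 :=
    (norm_mul_le _ _).trans <| (mul_le_mul hi.le h3 (norm_nonneg _) (by positivity)).trans
      (by field_simp; rfl)
  have h5 : 0 < ε / 2 * (1 / 2) ^ i := by positivity
  linarith

/-- The variation of the partial products `X, X * b₁, X * b₁ * b₂, …` over a word. -/
def prodVariation (X : 𝔸) : List 𝔸 → ℝ
  | [] => 0
  | b :: l => ‖X * b - X‖ + prodVariation (X * b) l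

theorem prodVariation_nonneg (X : 𝔸) (l : List 𝔸) : 0 ≤ prodVariation X l := by
  induction l generalizing X with
  | nil => exact le_rfl
  | cons b l ih => exact add_nonneg (norm_nonneg _) (ih _)

theorem prodVariation_append (X : 𝔸) (l₁ l₂ : List 𝔸) :
    prodVariation X (l₁ ++ l₂) = prodVariation X l₁ + prodVariation (X * l₁.prod) l₂ := by
  induction l₁ generalizing X with
  | nil => simp [prodVariation]
  | cons b l ih => simp [prodVariation, ih, mul_assoc, add_assoc]

theorem norm_mul_prod_sub_le (X : 𝔸) (l : List 𝔸) : ‖X * l.prod - X‖ ≤ prodVariation X l := by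
  induction l generalizing X with
  | nil => simp [prodVariation]
  | cons b l ih =>
    rw [List.prod_cons, ← mul_assoc, prodVariation]
    have := norm_add_le (X * b * l.prod - X * b) (X * b - X)
    rw [sub_add_sub_cancel] at this
    linarith [ih (X * b)]

theorem prodVariation_mul_le (Y X : 𝔸) (l : List 𝔸) :
    prodVariation (Y * X) l ≤ ‖Y‖ * prodVariation X l := by
  induction l generalizing X with
  | nil => simp [prodVariation]
  | cons b l ih =>
    rw [prodVariation, prodVariation, mul_add, mul_assoc, ← mul_sub]
    exact add_le_add (norm_mul_le _ _) (ih _)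

theorem prodVariation_le (X : 𝔸) (l : List 𝔸) : prodVariation X l ≤ ‖X‖ * prodVariation 1 l := by
  simpa using prodVariation_mul_le X 1 l

/-- Since `P` absorbs the letters, all partial products are shifted by the same `P`. This permits
the start `1 - P`, which is annihilated by `P`. -/
theorem prodVariation_sub {P : 𝔸} (X : 𝔸) {l : List 𝔸} (h : ∀ b ∈ l, P * b = P) :
    prodVariation (X - P) l = prodVariation X l := by
  induction l generalizing X with
  | nil => rfl
  | cons b l ih =>
    rw [prodVariation, prodVariation, sub_mul, h b (by simp), sub_sub_sub_cancel_right,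
      ih _ fun c hc => h c (by simp [hc])]

/-- A word over `J` is a concatenation of complete words, each of them minimal, followed by an
incomplete word. -/
theorem exists_eq_flatten_append {α : Type*} {J : Set α} (hJ : J.Nonempty) (l : List α)
    (hl : ∀ B ∈ l, B ∈ J) : ∃ (bs : List (List α)) (r : List α), l = bs.flatten ++ r ∧
      (∀ b ∈ bs, IsCompleteWord J b ∧ ∃ b' c, b = b' ++ [c] ∧ ¬ ∀ B ∈ J, B ∈ b') ∧
      ¬ ∀ B ∈ J, B ∈ r := by
  induction l using List.reverseRecOn with
  | nil =>
    obtain ⟨B, hB⟩ := hJ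
    exact ⟨[], [], rfl, by simp, fun h => by simpa using h B hB⟩
  | append_singleton l b ih =>
    obtain ⟨bs, r, rfl, hbs, hr⟩ := ih fun B hB => hl B (by simp [hB])
    by_cases h : ∀ B ∈ J, B ∈ r ++ [b]
    · obtain ⟨B, hB⟩ := hJ
      refine ⟨bs ++ [r ++ [b]], [], by simp, ?_, fun h => by simpa using h B hB⟩
      intro c hc
      rcases List.mem_append.1 hc with hc | hc
      · exact hbs c hc
      · rw [List.mem_singleton.1 hc]
        refine ⟨⟨fun B hB => hl B ?_, h⟩, r, b, rfl, hr⟩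
        rw [List.append_assoc]
        exact List.mem_append_right _ hB
    · exact ⟨bs, r ++ [b], by simp, hbs, h⟩

/-- Bounding `X` times every word, rather than `X` alone, makes the estimate linear in the number of
blocks instead of exponential. -/
theorem prodVariation_flatten_le {S : Set 𝔸} {D N : ℝ} (bs : List (List 𝔸))
    (hbs : ∀ b ∈ bs, (∀ B ∈ b, B ∈ S) ∧ prodVariation 1 b ≤ D) (X : 𝔸)
    (hX : ∀ l : List 𝔸, (∀ B ∈ l, B ∈ S) → ‖X * l.prod‖ ≤ N) :
    prodVariation X bs.flatten ≤ bs.length * (N * D) := by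
  induction bs generalizing X with
  | nil => simp [prodVariation]
  | cons b bs ih =>
    have hb := hbs b (by simp)
    have h1 := ih (fun c hc => hbs c (by simp [hc])) (X * b.prod) fun l hl => by
      rw [mul_assoc, ← List.prod_append]
      exact hX _ fun B hB => (List.mem_append.1 hB).elim (hb.1 B) (hl B)
    have hXN : ‖X‖ ≤ N := by simpa using hX [] (by simp)
    have h2 := (prodVariation_le X b).trans
      (mul_le_mul hXN hb.2 (prodVariation_nonneg _ _) ((norm_nonneg _).trans hXN))
    rw [List.flatten_cons, prodVariation_append, List.length_cons]
    push_cast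
    linarith

/-- A right convergent set that has a projection for each of its subsets has uniformly bounded
variation of products. -/
theorem RightConvergent.exists_prodVariation_le [NormedAlgebra ℝ 𝔸] [FiniteDimensional ℝ 𝔸]
    {Sig : Finset 𝔸} (h : RightConvergent Sig)
    (hP : ∀ J : Set 𝔸, J ⊆ Sig → ∃ P, IsFixProj J P) :
    ∃ C : ℝ, ∀ l : List 𝔸, (∀ B ∈ l, B ∈ Sig) → prodVariation 1 l ≤ C := by
  obtain ⟨K, hK0, hK⟩ := h.exists_norm_prod_le
  suffices H : ∀ J : Finset 𝔸, J ⊆ Sig → ∃ C : ℝ, ∀ l : List 𝔸, (∀ B ∈ l, B ∈ J) →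
      prodVariation 1 l ≤ C from H Sig subset_rfl
  intro J
  induction J using Finset.strongInduction with
  | H J ih =>
  intro hJ
  obtain rfl | hne := J.eq_empty_or_nonempty
  · refine ⟨0, fun l hl => ?_⟩
    obtain rfl : l = [] := List.eq_nil_iff_forall_not_mem.2 fun B hB => by simpa using hl B hB
    exact le_rfl
  classical
  -- Incomplete words use a proper subset of `J`; summing the constants over all such subsets covers
  -- them together.
  obtain ⟨C₀, hC0, hC₀⟩ : ∃ C : ℝ, 0 ≤ C ∧ ∀ l : List 𝔸, (∀ B ∈ l, B ∈ J) →
      (¬ ∀ B ∈ J, B ∈ l) → prodVariation 1 l ≤ C := by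
    choose! c hc using ih
    refine ⟨∑ J' ∈ J.ssubsets, |c J'|, Finset.sum_nonneg fun _ _ => abs_nonneg _,
      fun l hl hinc => ?_⟩
    have hsub : l.toFinset ⊂ J := by
      refine Finset.ssubset_iff_subset_ne.2 ⟨fun B hB => hl B (by simpa using hB), fun he => ?_⟩
      exact hinc fun B hB => by rw [← he] at hB; simpa using hB
    exact (hc _ hsub (hsub.subset.trans hJ) l fun B hB => by simpa using hB).trans
      ((le_abs_self _).trans (Finset.single_le_sum (f := fun J' => |c J'|)
        (fun _ _ => abs_nonneg _) (Finset.mem_ssubsets.2 hsub)))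
  obtain ⟨P, hP⟩ := hP J hJ
  obtain ⟨k, hk0, hk⟩ : ∃ k : ℕ, 0 < k ∧ ∀ bs : List (List 𝔸),
      (∀ b ∈ bs, IsCompleteWord (J : Set 𝔸) b) → k ≤ bs.length →
        ‖bs.flatten.prod - P‖ ≤ 1 / 2 := by
    obtain ⟨k, hk⟩ := h.exists_norm_prod_sub_le hJ hP (ε := 1 / 2) (by norm_num)
    -- Positivity of `k` guarantees that removing `k` blocks shortens the word in the induction
    -- below.
    exact ⟨k + 1, k.succ_pos, fun bs hbs hlen => hk bs hbs (by omega)⟩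
  have hKJ : ∀ l : List 𝔸, (∀ B ∈ l, B ∈ (J : Set 𝔸)) → ‖l.prod‖ ≤ K := fun l hl =>
    hK l fun B hB => hJ (hl B hB)
  -- A minimal complete block is an incomplete word plus one letter, whose increment is at most `2 *
  -- K`.
  set D : ℝ := C₀ + 2 * K
  have hD0 : 0 ≤ D := by positivity
  have hblock : ∀ b : List 𝔸, IsCompleteWord (J : Set 𝔸) b →
      (∃ b' c, b = b' ++ [c] ∧ ¬ ∀ B ∈ J, B ∈ b') → prodVariation 1 b ≤ D := by
    rintro _ hb ⟨b', c, rfl, hinc⟩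
    have h1 := hC₀ b' (fun B hB => hb.1 B (by simp [hB])) hinc
    have h2 := hKJ (b' ++ [c]) hb.1
    have h3 := hKJ b' (fun B hB => hb.1 B (by simp [hB]))
    rw [List.prod_append, List.prod_singleton] at h2
    rw [prodVariation_append]
    simp only [prodVariation, one_mul, add_zero]
    linarith [norm_sub_le (b'.prod * c) b'.prod]
  set E : ℝ := 2 * (k * (K * D) + K * C₀) with hE
  have hE0 : 0 ≤ E := by positivity
  have hvar : ∀ (bs : List (List 𝔸)) (X : 𝔸), bs.length ≤ k →
      (∀ b ∈ bs, IsCompleteWord (J : Set 𝔸) b ∧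
        ∃ b' c, b = b' ++ [c] ∧ ¬ ∀ B ∈ J, B ∈ b') →
      prodVariation X bs.flatten ≤ k * (K * D) * ‖X‖ := by
    intro bs X hlen hbs
    have h1 := prodVariation_flatten_le bs
      (fun b hb => ⟨(hbs b hb).1.1, hblock b (hbs b hb).1 (hbs b hb).2⟩) 1
      (N := K) (fun l hl => by simpa using hKJ l hl)
    have h2 : (bs.length : ℝ) * (K * D) ≤ k * (K * D) :=
      mul_le_mul_of_nonneg_right (by exact_mod_cast hlen) (by positivity)
    rw [mul_comm]
    exact (prodVariation_le _ _).trans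
      (mul_le_mul_of_nonneg_left (h1.trans h2) (norm_nonneg _))
  have hshort : ∀ (bs : List (List 𝔸)) (r : List 𝔸) (X : 𝔸), bs.length ≤ k →
      (∀ b ∈ bs, IsCompleteWord (J : Set 𝔸) b ∧
        ∃ b' c, b = b' ++ [c] ∧ ¬ ∀ B ∈ J, B ∈ b') →
      (∀ B ∈ r, B ∈ J) → (¬ ∀ B ∈ J, B ∈ r) →
      prodVariation X (bs.flatten ++ r) ≤ E * ‖X‖ := by
    intro bs r X hlen hbs hr hinc
    have h1 := hvar bs X hlen hbs
    have h2 : ‖X * bs.flatten.prod‖ ≤ ‖X‖ * K := (norm_mul_le _ _).trans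
      (mul_le_mul_of_nonneg_left (hKJ _ (mem_of_mem_flatten fun b hb => (hbs b hb).1.1))
        (norm_nonneg _))
    have h3 := (prodVariation_le (X * bs.flatten.prod) r).trans
      (mul_le_mul h2 (hC₀ r hr hinc) (prodVariation_nonneg _ _) (by positivity))
    rw [prodVariation_append]
    have : 0 ≤ (k * (K * D) + K * C₀) * ‖X‖ := by positivity
    rw [hE]; linarith
  -- The first `k` blocks cost at most `E / 2 * ‖X‖` and halve the norm of the start, so the rest
  -- costs at most `E / 2 * ‖X‖`. The condition `X * P = 0` persists because words fix `P`.
  have main : ∀ (m : ℕ) (bs : List (List 𝔸)) (r : List 𝔸) (X : 𝔸), bs.length ≤ m →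
      (∀ b ∈ bs, IsCompleteWord (J : Set 𝔸) b ∧
        ∃ b' c, b = b' ++ [c] ∧ ¬ ∀ B ∈ J, B ∈ b') →
      (∀ B ∈ r, B ∈ J) → (¬ ∀ B ∈ J, B ∈ r) → X * P = 0 →
      prodVariation X (bs.flatten ++ r) ≤ E * ‖X‖ := by
    intro m
    induction m with
    | zero =>
      intro bs r X hlen hbs hr hinc hX
      exact hshort bs r X (hlen.trans k.zero_le) hbs hr hinc
    | succ m ihm =>
      intro bs r X hlen hbs hr hinc hX
      rcases le_or_gt bs.length k with hlek | hgtk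
      · exact hshort bs r X hlek hbs hr hinc
      have hbs1 : ∀ b ∈ bs.take k, _ := fun b hb => hbs b (List.mem_of_mem_take hb)
      have hbs2 : ∀ b ∈ bs.drop k, _ := fun b hb => hbs b (List.mem_of_mem_drop hb)
      have hlen1 : (bs.take k).length = k := by simp [hgtk.le]
      have hlen2 : (bs.drop k).length ≤ m := by simp; omega
      have hsplit : bs.flatten ++ r = (bs.take k).flatten ++ ((bs.drop k).flatten ++ r) := by
        rw [← List.append_assoc, ← List.flatten_append, List.take_append_drop]
      have hw := mem_of_mem_flatten fun b hb => (hbs1 b hb).1.1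
      have h1 := hvar (bs.take k) X hlen1.le hbs1
      have h2 : ‖X * (bs.take k).flatten.prod‖ ≤ ‖X‖ * (1 / 2) := by
        have h3 := hk (bs.take k) (fun b hb => (hbs1 b hb).1) hlen1.ge
        have h4 : X * (bs.take k).flatten.prod = X * ((bs.take k).flatten.prod - P) := by
          rw [mul_sub, hX, sub_zero]
        rw [h4]
        exact (norm_mul_le _ _).trans (mul_le_mul_of_nonneg_left h3 (norm_nonneg _))
      have h3 := ihm (bs.drop k) r (X * (bs.take k).flatten.prod) hlen2 hbs2 hr hinc
        (by rw [mul_assoc, hP.prod_mul hw, hX])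
      rw [hsplit, prodVariation_append]
      have h4 := mul_le_mul_of_nonneg_left h2 hE0
      have h5 : k * (K * D) * ‖X‖ ≤ E * (‖X‖ * (1 / 2)) := by
        have : 0 ≤ K * C₀ * ‖X‖ := by positivity
        rw [hE]; linarith
      linarith
  refine ⟨E * ‖1 - P‖, fun l hl => ?_⟩
  obtain ⟨bs, r, rfl, hbs, hr⟩ := exists_eq_flatten_append (J := (J : Set 𝔸)) hne l hl
  rw [← prodVariation_sub (P := P) 1 fun b hb => hP.mul_right b (hl b hb)]
  exact main _ bs r _ le_rfl hbs (fun B hB => hl B (List.mem_append_right _ hB)) hr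
    (by rw [sub_mul, one_mul, hP.mul_self, sub_self])

end NormedRing

/-! ### Complete blocks and avoiding partitions in a linear order. -/

/-- Finitely many values are already taken on a finite subset. -/
theorem exists_finset_subset_image {R β : Type*} {A : R → β} {J : Set β} (hJ : J.Finite) {S : Set R}
    (h : J ⊆ A '' S) : ∃ F : Finset R, (F : Set R) ⊆ S ∧ J ⊆ A '' F := by
  classical
  rw [← hJ.coe_toFinset] at h ⊢
  obtain ⟨F, hFS, hF⟩ := Finset.subset_set_image_iff.1 h
  exact ⟨F, hFS, by rw [← hF, Finset.coe_image]⟩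

section Blocks

variable {R β : Type*} [LinearOrder R]

/-- `S` has `k` successive parts on each of which `A` takes all values in `J`. -/
def HasBlocks (A : R → β) (J : Set β) : ℕ → Set R → Prop
  | 0, _ => True
  | k + 1, S => ∃ x ∈ S, J ⊆ A '' (S ∩ Set.Iic x) ∧ HasBlocks A J k (S ∩ Set.Ioi x)

theorem HasBlocks.mono {A : R → β} {J : Set β} {k : ℕ} {S T : Set R} (h : HasBlocks A J k S)
    (hST : S ⊆ T) : HasBlocks A J k T := by
  induction k generalizing S T with
  | zero => trivial
  | succ k ih =>
    obtain ⟨x, hx, h1, h2⟩ := h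
    exact ⟨x, hST hx, h1.trans (Set.image_mono (Set.inter_subset_inter_left _ hST)),
      ih h2 (Set.inter_subset_inter_left _ hST)⟩

/-- If `A` takes the finitely many values in `J` on `S`, it does so up to some element of `S`. -/
theorem exists_subset_image_Iic {A : R → β} {J : Set β} (hJ : J.Finite) (hne : J.Nonempty)
    {S : Set R} (h : J ⊆ A '' S) : ∃ x ∈ S, J ⊆ A '' (S ∩ Set.Iic x) := by
  obtain ⟨F, hFS, hF⟩ := exists_finset_subset_image hJ h
  have hFne : F.Nonempty := by
    obtain ⟨j, hj⟩ := hne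
    obtain ⟨x, hx, -⟩ := hF hj
    exact ⟨x, hx⟩
  exact ⟨F.max' hFne, hFS (F.max'_mem hFne),
    hF.trans (Set.image_mono fun y hy => ⟨hFS hy, F.le_max' y hy⟩)⟩

theorem exists_subset_image_Ici {A : R → β} {J : Set β} (hJ : J.Finite) (hne : J.Nonempty)
    {S : Set R} (h : J ⊆ A '' S) : ∃ x ∈ S, J ⊆ A '' (S ∩ Set.Ici x) :=
  exists_subset_image_Iic (R := Rᵒᵈ) hJ hne h

theorem HasBlocks.exists_finset {A : R → β} {J : Set β} (hJ : J.Finite) {k : ℕ} {S : Set R}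
    (h : HasBlocks A J k S) : ∃ F : Finset R, (F : Set R) ⊆ S ∧ HasBlocks A J k F := by
  classical
  induction k generalizing S with
  | zero => exact ⟨∅, by simp, trivial⟩
  | succ k ih =>
    obtain ⟨x, hx, h1, h2⟩ := h
    obtain ⟨F₁, hF₁, hJF₁⟩ := exists_finset_subset_image hJ h1
    obtain ⟨F₂, hF₂, hB⟩ := ih h2
    refine ⟨insert x (F₁ ∪ F₂), ?_, x, by simp, hJF₁.trans (Set.image_mono fun y hy => ?_),
      hB.mono fun y hy => ?_⟩
    · intro y hy
      simp only [Finset.coe_insert, Finset.coe_union, Set.mem_insert_iff, Set.mem_union] at hy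
      rcases hy with rfl | hy | hy
      exacts [hx, (hF₁ hy).1, (hF₂ hy).1]
    · exact ⟨by simp [Finset.mem_coe.1 hy], (hF₁ hy).2⟩
    · exact ⟨by simp [Finset.mem_coe.1 hy], (hF₂ hy).2⟩

/-- A further complete part at the right end gives a further block. -/
theorem HasBlocks.succ_of_inter_Iio {A : R → β} {J : Set β} (hJ : J.Finite) (hne : J.Nonempty)
    {k : ℕ} {S : Set R} {u : R} (h : HasBlocks A J k (S ∩ Set.Iio u))
    (hu : J ⊆ A '' (S ∩ Set.Ici u)) : HasBlocks A J (k + 1) S := by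
  induction k generalizing S with
  | zero =>
    obtain ⟨x, hx, h1⟩ := exists_subset_image_Iic hJ hne (hu.trans (Set.image_mono Set.inter_subset_left))
    exact ⟨x, hx, h1, trivial⟩
  | succ k ih =>
    obtain ⟨x, hx, h1, h2⟩ := h
    refine ⟨x, hx.1, h1.trans (Set.image_mono fun y hy => ⟨hy.1.1, hy.2⟩), ih ?_ ?_⟩
    · exact h2.mono fun y hy => ⟨⟨hy.1.1, hy.2⟩, hy.1.2⟩
    · exact hu.trans (Set.image_mono fun y hy => ⟨⟨hy.1, hx.2.trans_le hy.2⟩, hy.2⟩)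

theorem IsIntervalOf.of_isIntervalOf_inter {S D T : Set R} (hD : D.OrdConnected)
    (h : IsIntervalOf (S ∩ D) T) : IsIntervalOf S T :=
  ⟨h.1.trans Set.inter_subset_left, fun a ha b hb g hg hag hgb =>
    h.2 a ha b hb g ⟨hg, hD.out (h.1 ha).2 (h.1 hb).2 ⟨hag.le, hgb.le⟩⟩ hag hgb⟩

/-- Disjoint complete intervals provide blocks. -/
theorem hasBlocks_of_disjoint_intervals {A : R → β} {J : Set β} (hJ : J.Finite)
    (hne : J.Nonempty) {ι : Type*} (I : Finset ι) {S : Set R} (T : ι → Set R)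
    (hT : ∀ i ∈ I, IsIntervalOf S (T i) ∧ J ⊆ A '' T i)
    (hd : ∀ i ∈ I, ∀ j ∈ I, i ≠ j → Disjoint (T i) (T j)) : HasBlocks A J I.card S := by
  classical
  induction hI : I.card generalizing I S with
  | zero => trivial
  | succ k ih =>
    have hIne : I.Nonempty := Finset.card_pos.1 (by omega)
    have h1 : ∀ i ∈ I, ∃ x ∈ T i, J ⊆ A '' (T i ∩ Set.Iic x) := fun i hi =>
      exists_subset_image_Iic hJ hne (hT i hi).2
    have : Nonempty R := ⟨(h1 _ hIne.choose_spec).choose⟩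
    choose! x hx hxJ using h1
    obtain ⟨i, hi, hmin⟩ := I.exists_min_image x hIne
    -- A point of `T j` left of the smallest marker `x i`, together with `x j` on its right, would
    -- put `x i` into `T j`.
    have hsub : ∀ j ∈ I.erase i, T j ⊆ Set.Ioi (x i) := by
      intro j hj t ht
      obtain ⟨hji, hjI⟩ := Finset.mem_erase.1 hj
      have hxi : x i ∉ T j := fun h => Set.disjoint_left.1 (hd j hjI i hi hji) h (hx i hi)
      by_contra hlt
      have hti : t < x i := lt_of_le_of_ne (not_lt.1 hlt) fun h => hxi (h ▸ ht)
      have hij : x i < x j := lt_of_le_of_ne (hmin j hjI) fun h => hxi (h ▸ hx j hjI)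
      exact hxi ((hT j hjI).1.2 t ht _ (hx j hjI) _ ((hT i hi).1.1 (hx i hi)) hti hij)
    refine ⟨x i, (hT i hi).1.1 (hx i hi), (hxJ i hi).trans
      (Set.image_mono (Set.inter_subset_inter_left _ (hT i hi).1.1)), ?_⟩
    refine ih (I.erase i) (fun j hj => ⟨⟨fun t ht => ⟨(hT j ?_).1.1 ht, hsub j hj ht⟩, ?_⟩, ?_⟩)
      (fun j hj j' hj' => hd j (Finset.mem_of_mem_erase hj) j' (Finset.mem_of_mem_erase hj')) ?_
    · exact Finset.mem_of_mem_erase hj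
    · exact fun a ha b hb g hg => (hT j (Finset.mem_of_mem_erase hj)).1.2 a ha b hb g hg.1
    · exact (hT j (Finset.mem_of_mem_erase hj)).2
    · rw [Finset.card_erase_of_mem hi, hI]; rfl

theorem HasBlocks.exists_disjoint_intervals {A : R → β} {J : Set β} {k : ℕ} {S : Set R}
    (h : HasBlocks A J k S) : ∃ T : Fin k → Set R,
      (∀ i, IsIntervalOf S (T i) ∧ J ⊆ A '' T i) ∧ ∀ i j, i ≠ j → Disjoint (T i) (T j) := by
  induction k generalizing S with
  | zero => exact ⟨fun _ => ∅, fun i => i.elim0, fun i => i.elim0⟩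
  | succ k ih =>
    obtain ⟨x, hx, h1, h2⟩ := h
    obtain ⟨T, hT, hd⟩ := ih h2
    have h0 : ∀ i, Disjoint (S ∩ Set.Iic x) (T i) := fun i =>
      Set.disjoint_left.2 fun y hy hyT => not_lt.2 hy.2 ((hT i).1.1 hyT).2
    refine ⟨Fin.cons (S ∩ Set.Iic x) T, fun i => ?_, fun i j hij => ?_⟩
    · induction i using Fin.cases with
      | zero => exact ⟨⟨Set.inter_subset_left, fun a _ b hb g hg _ hgb =>
          ⟨hg, hgb.le.trans hb.2⟩⟩, h1⟩
      | succ i => exact ⟨(hT i).1.of_isIntervalOf_inter Set.ordConnected_Ioi, (hT i).2⟩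
    · induction i using Fin.cases with
      | zero =>
        induction j using Fin.cases with
        | zero => exact absurd rfl hij
        | succ j => exact h0 j
      | succ i =>
        induction j using Fin.cases with
        | zero => exact (h0 i).symm
        | succ j => exact hd i j fun h => hij (h ▸ rfl)

/-- A list of intervals of `S` in increasing order that covers `S` and on none of which `A` takes
all values in `J`. -/
structure IsAvoidingPartition (A : R → β) (J : Set β) (S : Set R) (l : List (Set R)) : Prop where
  interval : ∀ T ∈ l, IsIntervalOf S T
  incomplete : ∀ T ∈ l, ¬ J ⊆ A '' T
  increasing : l.Pairwise fun T T' => ∀ a ∈ T, ∀ b ∈ T', a < b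
  cover : ∀ x ∈ S, ∃ T ∈ l, x ∈ T

theorem IsAvoidingPartition.singleton {A : R → β} {J : Set β} {S : Set R} (h : ¬ J ⊆ A '' S) :
    IsAvoidingPartition A J S [S] where
  interval := by simp +contextual [IsIntervalOf]
  incomplete := by simpa using h
  increasing := by simp
  cover := by simp

theorem IsAvoidingPartition.append {A : R → β} {J : Set β} {S D E : Set R} {l m : List (Set R)}
    (hl : IsAvoidingPartition A J (S ∩ D) l) (hm : IsAvoidingPartition A J (S ∩ E) m)
    (hD : D.OrdConnected) (hE : E.OrdConnected) (hDE : ∀ a ∈ S ∩ D, ∀ b ∈ S ∩ E, a < b)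
    (hcov : ∀ x ∈ S, x ∈ D ∨ x ∈ E) : IsAvoidingPartition A J S (l ++ m) where
  interval T hT := (List.mem_append.1 hT).elim
    (fun h => (hl.interval T h).of_isIntervalOf_inter hD)
    (fun h => (hm.interval T h).of_isIntervalOf_inter hE)
  incomplete T hT := (List.mem_append.1 hT).elim (hl.incomplete T) (hm.incomplete T)
  increasing := List.pairwise_append.2 ⟨hl.increasing, hm.increasing, fun T hT T' hT' a ha b hb =>
    hDE a ((hl.interval T hT).1 ha) b ((hm.interval T' hT').1 hb)⟩
  cover x hx := by
    rcases hcov x hx with h | h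
    · obtain ⟨T, hT, hxT⟩ := hl.cover x ⟨hx, h⟩
      exact ⟨T, List.mem_append_left _ hT, hxT⟩
    · obtain ⟨T, hT, hxT⟩ := hm.cover x ⟨hx, h⟩
      exact ⟨T, List.mem_append_right _ hT, hxT⟩

/-- Greedy cutting at the place where `J` is first exhausted. That place may be a gap rather than a
point, so the part beyond it needs a case distinction before the induction on `k` applies. Two
distinct values in `J` make single points avoiding. -/
theorem exists_isAvoidingPartition {A : R → β} {J : Set β} (hJ : J.Finite) (hJ2 : J.Nontrivial)
    {k : ℕ} {S : Set R} (h : ¬ HasBlocks A J k S) : ∃ l, IsAvoidingPartition A J S l := by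
  induction k generalizing S with
  | zero => exact absurd trivial h
  | succ k ih =>
    have hne := hJ2.nonempty
    set U : Set R := {x | J ⊆ A '' (S ∩ Set.Iic x)}
    have hUup : ∀ x ∈ U, ∀ y, x ≤ y → y ∈ U := fun x hx y hxy =>
      Set.Subset.trans hx (Set.image_mono (Set.inter_subset_inter_right _ (Set.Iic_subset_Iic.2 hxy)))
    have hUc : U.OrdConnected := ⟨fun x hx y _ z hz => hUup x hx z hz.1⟩
    have hUc' : (Uᶜ).OrdConnected := ⟨fun x _ y hy z hz h => hy (hUup z h y hz.2)⟩
    -- Finitely many values would be exhausted by some point of this part, which would then belong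
    -- to `U`.
    have hL : ¬ J ⊆ A '' (S ∩ Uᶜ) := fun hcon => by
      obtain ⟨x, hx, hx'⟩ := exists_subset_image_Iic hJ hne hcon
      exact hx.2 (hx'.trans (Set.image_mono fun y hy => ⟨hy.1.1, hy.2⟩))
    have hgt : ∀ u ∈ S ∩ U, ∃ l, IsAvoidingPartition A J (S ∩ Set.Ioi u) l := fun u hu =>
      ih fun hb => h ⟨u, hu.1, hu.2, hb⟩
    suffices H : ∃ l, IsAvoidingPartition A J (S ∩ U) l by
      obtain ⟨l, hl⟩ := H
      exact ⟨_, (IsAvoidingPartition.singleton hL).append hl hUc' hUc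
        (fun a ha b hb => not_le.1 fun hab => ha.2 (hUup b hb.2 a hab))
        fun x _ => (em (x ∈ U)).symm⟩
    by_cases hUi : J ⊆ A '' (S ∩ U)
    swap
    · exact ⟨_, IsAvoidingPartition.singleton hUi⟩
    by_cases hmin : ∃ u ∈ S ∩ U, ∀ x ∈ S ∩ U, u ≤ x
    · obtain ⟨u, hu, humin⟩ := hmin
      obtain ⟨l, hl⟩ := hgt u hu
      have h1 : ¬ J ⊆ A '' (S ∩ U ∩ {u}) := fun hcon => by
        obtain ⟨x, hx, y, hy, hxy⟩ := hJ2
        obtain ⟨a, ha, rfl⟩ := hcon hx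
        obtain ⟨b, hb, rfl⟩ := hcon hy
        exact hxy (by rw [ha.2, hb.2])
      have h2 : S ∩ Set.Ioi u = S ∩ U ∩ Set.Ioi u := by
        ext y
        exact ⟨fun hy => ⟨⟨hy.1, hUup u hu.2 y (le_of_lt hy.2)⟩, hy.2⟩, fun hy => ⟨hy.1.1, hy.2⟩⟩
      rw [h2] at hl
      refine ⟨_, (IsAvoidingPartition.singleton h1).append hl Set.ordConnected_singleton
        Set.ordConnected_Ioi ?_ ?_⟩
      · rintro a ⟨-, rfl⟩ b ⟨-, hb⟩
        exact hb
      · exact fun x hx => (humin x hx).eq_or_lt.imp (fun h => h.symm) id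
    · push Not at hmin
      -- Cut at `u` with a complete part from `u` on. Left of `u`, `k` blocks would be extended by
      -- that part to `k + 1`; from `u` on, `k` blocks would follow the complete part up to the
      -- smaller point `u'`.
      obtain ⟨u, hu, hJu⟩ := exists_subset_image_Ici hJ hne hUi
      obtain ⟨u', hu', hlt⟩ := hmin u hu
      obtain ⟨l, hl⟩ : ∃ l, IsAvoidingPartition A J (S ∩ U ∩ Set.Iio u) l :=
        ih fun hb => h ((hb.succ_of_inter_Iio hJ hne hJu).mono Set.inter_subset_left)
      obtain ⟨m, hm⟩ : ∃ l, IsAvoidingPartition A J (S ∩ U ∩ Set.Ici u) l :=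
        ih fun hb => h ⟨u', hu'.1, hu'.2, hb.mono fun y hy => ⟨hy.1.1, hlt.trans_le hy.2⟩⟩
      exact ⟨_, hl.append hm Set.ordConnected_Iio Set.ordConnected_Ici
        (fun a ha b hb => ha.2.trans_le hb.2) fun x _ => lt_or_ge x u⟩

end Blocks

/-! ### Finite words approximating a product over `S`. -/

section PartialWord

variable {R β : Type*} [LinearOrder R]

/-- The values of `A` on `F ∩ S`, in increasing order of the arguments. -/
noncomputable def partialWord (A : R → β) (S : Set R) (F : Finset R) : List β :=
  open Classical in ((F.filter (· ∈ S)).sort (· ≤ ·)).map A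

theorem mem_partialWord {A : R → β} {S : Set R} {F : Finset R} {B : β} :
    B ∈ partialWord A S F ↔ ∃ x ∈ F, x ∈ S ∧ A x = B := by
  simp [partialWord, and_assoc]

theorem partialWord_of_eq_union {A : R → β} {S T U : Set R} (hU : U = S ∪ T)
    (h : ∀ a ∈ S, ∀ b ∈ T, a < b) (F : Finset R) :
    partialWord A U F = partialWord A S F ++ partialWord A T F := by
  classical
  subst hU
  unfold partialWord
  rw [← List.map_append]
  congr 1
  refine List.Perm.eq_of_pairwise (le := (· ≤ ·)) (fun a b _ _ => le_antisymm)
    (Finset.pairwise_sort _ _) ?_ ?_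
  · refine List.pairwise_append.2 ⟨Finset.pairwise_sort _ _, Finset.pairwise_sort _ _, ?_⟩
    intro a ha b hb
    simp only [Finset.mem_sort, Finset.mem_filter] at ha hb
    exact (h a ha.2 b hb.2).le
  · refine (List.perm_ext_iff_of_nodup (Finset.sort_nodup _ _) ?_).2 fun a => ?_
    · refine List.nodup_append.2 ⟨Finset.sort_nodup _ _, Finset.sort_nodup _ _, ?_⟩
      intro a ha b hb
      simp only [Finset.mem_sort, Finset.mem_filter] at ha hb
      exact (h a ha.2 b hb.2).ne
    · simp only [List.mem_append, Finset.mem_sort, Finset.mem_filter, Set.mem_union]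
      tauto

theorem partialWord_of_pairwise [Monoid β] {A : R → β} (F : Finset R) (l : List (Set R))
    (hl : l.Pairwise fun T T' => ∀ a ∈ T, ∀ b ∈ T', a < b) {S : Set R}
    (hS : ∀ x, x ∈ S ↔ ∃ T ∈ l, x ∈ T) :
    (partialWord A S F).prod = (l.map fun T => (partialWord A T F).prod).prod := by
  induction l generalizing S with
  | nil =>
    obtain rfl : S = ∅ := Set.eq_empty_of_forall_notMem fun x hx => by simpa using (hS x).1 hx
    simp [partialWord]
  | cons T l ih =>
    rw [List.pairwise_cons] at hl
    rw [partialWord_of_eq_union (S := T) (T := {x | ∃ T ∈ l, x ∈ T})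
      (by ext x; simp [hS]) (by rintro a ha b ⟨T', hT', hb⟩; exact hl.1 T' hT' a ha b hb),
      List.prod_append, List.map_cons, List.prod_cons]
    exact congrArg _ (ih hl.2 fun x => Iff.rfl)

/-- Blocks of `F ∩ S` are complete subwords of the word of `A` on `F ∩ S`. -/
theorem HasBlocks.exists_eq_flatten_append {A : R → β} {J : Set β} {k : ℕ} {S : Set R}
    {F : Finset R} (h : HasBlocks A J k (S ∩ F)) (hS : A '' S ⊆ J) :
    ∃ (bs : List (List β)) (r : List β), partialWord A S F = bs.flatten ++ r ∧ bs.length = k ∧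
      (∀ b ∈ bs, IsCompleteWord J b) ∧ ∀ B ∈ r, B ∈ J := by
  have hmem : ∀ T ⊆ S, ∀ B ∈ partialWord A T F, B ∈ J := fun T hT B hB => by
    obtain ⟨x, -, hx, rfl⟩ := mem_partialWord.1 hB
    exact hS ⟨x, hT hx, rfl⟩
  induction k generalizing S with
  | zero => exact ⟨[], _, rfl, rfl, by simp, hmem S subset_rfl⟩
  | succ k ih =>
    obtain ⟨x, hx, h1, h2⟩ := h
    have hsub : S ∩ Set.Ioi x ⊆ S := Set.inter_subset_left
    obtain ⟨bs, r, he, hlen, hbs, hr⟩ := ih (S := S ∩ Set.Ioi x)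
      (h2.mono fun y hy => ⟨⟨hy.1.1, hy.2⟩, hy.1.2⟩) ((Set.image_mono hsub).trans hS)
      fun T hT => hmem T (hT.trans hsub)
    refine ⟨partialWord A (S ∩ Set.Iic x) F :: bs, r, ?_, by simp [hlen], ?_, hr⟩
    · rw [partialWord_of_eq_union (S := S ∩ Set.Iic x) (T := S ∩ Set.Ioi x)
        (by rw [← Set.inter_union_distrib_left, Set.Iic_union_Ioi, Set.inter_univ])
        fun a ha b hb => ha.2.trans_lt hb.2, he]
      simp
    · intro b hb
      rcases List.mem_cons.1 hb with rfl | hb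
      · refine ⟨hmem _ Set.inter_subset_left, fun B hB => ?_⟩
        obtain ⟨y, hy, rfl⟩ := h1 hB
        exact mem_partialWord.2 ⟨y, hy.1.2, ⟨hy.1.1, hy.2⟩, rfl⟩
      · exact hbs b hb

/-- Words of growing lower sets extend one another on the right, so each difference skips over some
partial products of the final word. -/
theorem prodVariation_partialWord_lower {𝔸 : Type*} [NormedRing 𝔸] {A : R → 𝔸} {D : ℕ → Set R}
    (hD : Monotone D) (hlow : ∀ i, IsLowerSet (D i)) (F : Finset R) (m : ℕ) :
    ∑ i ∈ Finset.range m, ‖(partialWord A (D (i + 1)) F).prod - (partialWord A (D i) F).prod‖ ≤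
      prodVariation 1 (partialWord A (D m) F) := by
  induction m with
  | zero => simpa using prodVariation_nonneg _ _
  | succ m ih =>
    rw [Finset.sum_range_succ, partialWord_of_eq_union (U := D (m + 1)) (S := D m)
      (T := D (m + 1) \ D m) (Set.union_sdiff_cancel (hD m.le_succ)).symm
      (fun a ha b hb => not_le.1 fun hba => hb.2 (hlow m hba ha)), prodVariation_append,
      List.prod_append, one_mul]
    exact add_le_add ih (norm_mul_prod_sub_le _ _)

/-- Words of shrinking upper sets are suffixes of one another; reversal in the opposite ring makes
them prefixes. The second summand on the left is the variation not yet spent, which lets the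
induction peel from the large end. -/
theorem prodVariation_partialWord_upper {𝔸 : Type*} [NormedRing 𝔸] {A : R → 𝔸} {D : ℕ → Set R}
    (hD : Antitone D) (hup : ∀ i, IsUpperSet (D i)) (F : Finset R) (m : ℕ) :
    ∑ i ∈ Finset.range m, ‖(partialWord A (D (i + 1)) F).prod - (partialWord A (D i) F).prod‖ +
      prodVariation 1 (((partialWord A (D m) F).map MulOpposite.op).reverse) ≤
      prodVariation 1 (((partialWord A (D 0) F).map MulOpposite.op).reverse) := by
  induction m with
  | zero => simp
  | succ m ih =>
    refine le_trans ?_ ih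
    rw [Finset.sum_range_succ, add_assoc]
    refine add_le_add_right ?_ _
    rw [partialWord_of_eq_union (U := D m) (T := D (m + 1)) (S := D m \ D (m + 1))
      (Set.sdiff_union_of_subset (hD m.le_succ)).symm
      (fun a ha b hb => not_le.1 fun hba => ha.2 (hup (m + 1) hba hb)), List.map_append,
      List.reverse_append, prodVariation_append, one_mul, add_comm]
    refine add_le_add_right (le_trans (le_of_eq ?_) (norm_mul_prod_sub_le _ _)) _
    rw [← MulOpposite.op_list_prod, ← MulOpposite.op_list_prod, ← MulOpposite.op_mul,
      ← MulOpposite.op_sub, MulOpposite.norm_op, List.prod_append, norm_sub_rev]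

end PartialWord

/-! ### Matrices: convergence hypotheses and projections as inputs to the abstract results. -/

section Matrix

variable {n : ℕ}

attribute [local instance] Matrix.linftyOpNormedRing Matrix.linftyOpNormedAlgebra

theorem rightProd_eq_prod (s : ℕ → Matrix (Fin n) (Fin n) ℝ) (m : ℕ) :
    rightProd s m = ((List.range m).map s).prod := by
  induction m with
  | zero => rfl
  | succ m ih => simp [rightProd, List.range_succ, ih]

theorem op_leftProd_eq_prod (s : ℕ → Matrix (Fin n) (Fin n) ℝ) (m : ℕ) :
    MulOpposite.op (leftProd s m) = ((List.range m).map fun i => MulOpposite.op (s i)).prod := by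
  induction m with
  | zero => rfl
  | succ m ih => simp [leftProd, List.range_succ, ih]

theorem IsRCP.rightConvergent {Sig : Finset (Matrix (Fin n) (Fin n) ℝ)}
    (h : IsRCP (Sig : Set (Matrix (Fin n) (Fin n) ℝ))) : RightConvergent Sig := by
  intro s hs
  obtain ⟨L, hL⟩ := h s hs
  exact ⟨L, hL.congr fun m => rightProd_eq_prod s m⟩

theorem IsLCP.rightConvergent_op {Sig : Finset (Matrix (Fin n) (Fin n) ℝ)}
    (h : IsLCP (Sig : Set (Matrix (Fin n) (Fin n) ℝ))) :
    RightConvergent (Sig.map MulOpposite.opEquiv.toEmbedding) := by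
  intro s hs
  obtain ⟨L, hL⟩ := h (fun i => (s i).unop) fun i => by
    obtain ⟨B, hB, hBs⟩ := Finset.mem_map.1 (hs i)
    rw [← hBs]
    exact hB
  exact ⟨MulOpposite.op L, ((MulOpposite.continuous_op.tendsto L).comp hL).congr fun m =>
    op_leftProd_eq_prod _ m⟩

theorem mem_commonKer {T : Set (Matrix (Fin n) (Fin n) ℝ)} {x : Fin n → ℝ} :
    x ∈ commonKer T ↔ ∀ B ∈ T, B.mulVec x = x := by
  simp [commonKer, Submodule.mem_iInf, sub_eq_zero, eq_comm]

theorem sub_mulVec_mem_rangeSpan {T : Set (Matrix (Fin n) (Fin n) ℝ)}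
    {B : Matrix (Fin n) (Fin n) ℝ} (hB : B ∈ T) (x : Fin n → ℝ) :
    x - B.mulVec x ∈ rangeSpan T := by
  refine Submodule.mem_iSup_of_mem B (Submodule.mem_iSup_of_mem hB ⟨x, ?_⟩)
  simp

theorem projMatrix_mulVec {T : Set (Matrix (Fin n) (Fin n) ℝ)}
    (h : IsCompl (commonKer T) (rangeSpan T)) (x : Fin n → ℝ) :
    (projMatrix T).mulVec x = Submodule.projection _ _ h x := by
  rw [projMatrix, dif_pos h, LinearMap.toMatrix'_mulVec]

theorem mul_projMatrix {T : Set (Matrix (Fin n) (Fin n) ℝ)}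
    (h : IsCompl (commonKer T) (rangeSpan T))
    {B : Matrix (Fin n) (Fin n) ℝ} (hB : B ∈ T) :
    B * projMatrix T = projMatrix T := by
  refine Matrix.ext_of_mulVec_single fun i => ?_
  rw [← Matrix.mulVec_mulVec, projMatrix_mulVec h]
  exact mem_commonKer.1 (Submodule.projection_apply_mem h _) B hB

theorem projMatrix_mul {T : Set (Matrix (Fin n) (Fin n) ℝ)}
    (h : IsCompl (commonKer T) (rangeSpan T))
    {B : Matrix (Fin n) (Fin n) ℝ} (hB : B ∈ T) :
    projMatrix T * B = projMatrix T := by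
  refine Matrix.ext_of_mulVec_single fun i => ?_
  rw [← Matrix.mulVec_mulVec, projMatrix_mulVec h, projMatrix_mulVec h, eq_comm, ← sub_eq_zero,
    ← map_sub, Submodule.projection_apply_eq_zero_iff]
  exact sub_mulVec_mem_rangeSpan hB _

theorem projMatrix_mul_of_fix {T : Set (Matrix (Fin n) (Fin n) ℝ)}
    (h : IsCompl (commonKer T) (rangeSpan T))
    {X : Matrix (Fin n) (Fin n) ℝ} (hX : ∀ B ∈ T, B * X = X) :
    projMatrix T * X = X := by
  refine Matrix.ext_of_mulVec_single fun i => ?_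
  rw [← Matrix.mulVec_mulVec, projMatrix_mulVec h]
  refine Submodule.projection_apply_of_mem_left h (mem_commonKer.2 fun B hB => ?_)
  rw [Matrix.mulVec_mulVec, hX B hB]

/-- `X` vanishes on every range of `1 - B`, hence on `rangeSpan T`, which contains `x - P x` for the
projection `P`. -/
theorem mul_projMatrix_of_fix {T : Set (Matrix (Fin n) (Fin n) ℝ)}
    (h : IsCompl (commonKer T) (rangeSpan T))
    {X : Matrix (Fin n) (Fin n) ℝ} (hX : ∀ B ∈ T, X * B = X) :
    X * projMatrix T = X := by
  have hR : rangeSpan T ≤ LinearMap.ker (Matrix.toLin' X) := by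
    refine iSup₂_le fun B hB => ?_
    rintro _ ⟨y, rfl⟩
    simp [Matrix.mulVec_sub, hX B hB]
  refine Matrix.ext_of_mulVec_single fun i => ?_
  rw [← Matrix.mulVec_mulVec, eq_comm, ← sub_eq_zero, ← Matrix.mulVec_sub]
  have h1 : Pi.single i 1 - (projMatrix T).mulVec (Pi.single i 1) ∈ rangeSpan T := by
    rw [← Submodule.projection_apply_eq_zero_iff h, map_sub, projMatrix_mulVec h,
      Submodule.projection_apply_of_mem_left h (Submodule.projection_apply_mem h _), sub_self]
  simpa using hR h1

theorem isFixProj_projMatrix {T : Set (Matrix (Fin n) (Fin n) ℝ)}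
    (h : IsCompl (commonKer T) (rangeSpan T)) : IsFixProj T (projMatrix T) :=
  ⟨fun _ => mul_projMatrix h, fun _ => projMatrix_mul h, fun _ => mul_projMatrix_of_fix h⟩

theorem isFixProj_op_projMatrix {T : Set (Matrix (Fin n) (Fin n) ℝ)}
    (h : IsCompl (commonKer T) (rangeSpan T)) :
    IsFixProj (MulOpposite.unop ⁻¹' T) (MulOpposite.op (projMatrix T)) where
  mul_left _ hB := MulOpposite.unop_injective (projMatrix_mul h hB)
  mul_right _ hB := MulOpposite.unop_injective (mul_projMatrix h hB)
  fix _ hX := MulOpposite.unop_injective (projMatrix_mul_of_fix h fun B hB =>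
    MulOpposite.op_injective (hX (MulOpposite.op B) hB))

end Matrix

/-! ### Products over infinite sets as limits, and their variation. -/

section Limit

variable {n : ℕ} {R : Type*} [LinearOrder R]

theorem le_completeCount {A : R → Matrix (Fin n) (Fin n) ℝ} {S : Set R} {m : ℕ}
    {T : Fin m → Set R} (hT : ∀ i, IsIntervalOf S (T i) ∧ A '' S ⊆ A '' T i)
    (hd : ∀ i j, i ≠ j → Disjoint (T i) (T j)) : (m : ℕ∞) ≤ completeCount A S :=
  le_sSup ⟨m, T, rfl, fun i => ⟨(hT i).1, (Set.image_mono (hT i).1.1).antisymm (hT i).2⟩, hd⟩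

theorem hasBlocks_of_completeCount_eq_top {A : R → Matrix (Fin n) (Fin n) ℝ} {S : Set R}
    (hfin : (A '' S).Finite) (hne : S.Nonempty) (h : completeCount A S = ⊤) (k : ℕ) :
    HasBlocks A (A '' S) k S := by
  have h1 : (k : ℕ∞) < completeCount A S := h ▸ ENat.natCast_lt_top k
  obtain ⟨c, ⟨m, T, rfl, hT, hd⟩, hlt⟩ := lt_sSup_iff.1 h1
  obtain ⟨I, -, rfl⟩ := Finset.exists_subset_card_eq (s := (Finset.univ : Finset (Fin m)))
    (n := k) (by simpa using (Nat.cast_lt.1 hlt).le)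
  exact hasBlocks_of_disjoint_intervals hfin (hne.image A) I T
    (fun i _ => ⟨(hT i).1, (hT i).2.ge⟩) fun i _ j _ => hd i j

theorem exists_not_hasBlocks {A : R → Matrix (Fin n) (Fin n) ℝ} {S : Set R}
    (h : completeCount A S ≠ ⊤) : ∃ k, ¬ HasBlocks A (A '' S) k S := by
  by_contra! hcon
  refine h (ENat.eq_top_iff_forall_ge.2 fun m => ?_)
  obtain ⟨T, hT, hd⟩ := (hcon m).exists_disjoint_intervals
  exact le_completeCount hT hd

/-- With at most one value every singleton in `S` is complete. Hence the partition case of the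
recursion occurs only with at least two values. -/
theorem completeCount_eq_top_of_subsingleton {A : R → Matrix (Fin n) (Fin n) ℝ} {S : Set R}
    (hS : S.Infinite) (h : (A '' S).Subsingleton) : completeCount A S = ⊤ := by
  refine ENat.eq_top_iff_forall_ge.2 fun m => ?_
  refine le_completeCount (T := fun i : Fin m => {(hS.natEmbedding S i : R)})
    (fun i => ⟨⟨?_, ?_⟩, ?_⟩) fun i j hij => ?_
  · simp
  · rintro a rfl b rfl g - h1 h2
    exact absurd (h1.trans h2) (lt_irrefl _)
  · intro B hB
    exact ⟨_, rfl, h ⟨_, (hS.natEmbedding S i).2, rfl⟩ hB⟩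
  · rw [Set.disjoint_singleton]
    intro he
    exact hij (Fin.ext ((hS.natEmbedding S).injective (Subtype.ext he)))

theorem exists_isIncompletePartition {A : R → Matrix (Fin n) (Fin n) ℝ} {S : Set R}
    (hfin : (A '' S).Finite) (hS : S.Infinite) (h : completeCount A S ≠ ⊤) :
    ∃ l, IsIncompletePartition A S l := by
  have hnt : (A '' S).Nontrivial := Set.not_subsingleton_iff.1 fun hs =>
    h (completeCount_eq_top_of_subsingleton hS hs)
  obtain ⟨k, hk⟩ := exists_not_hasBlocks h
  obtain ⟨l, hl⟩ := exists_isAvoidingPartition hfin hnt hk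
  exact ⟨l, hl.interval, fun T hT he => hl.incomplete T hT he.ge, hl.increasing, hl.cover⟩

section Convergence

attribute [local instance] Matrix.linftyOpNormedRing Matrix.linftyOpNormedAlgebra

/-- The product over `S` is the limit of the products over the finite subsets of `S`. -/
theorem tendsto_prod_partialWord {Sig : Finset (Matrix (Fin n) (Fin n) ℝ)}
    (hSig : IsCP (Sig : Set (Matrix (Fin n) (Fin n) ℝ))) {A : R → Matrix (Fin n) (Fin n) ℝ}
    (hA : ∀ r, A r ∈ Sig) (S : Set R) :
    Tendsto (fun F => (partialWord A S F).prod) atTop (𝓝 (contProd A S)) := by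
  have hsub : ∀ S, A '' S ⊆ Sig := fun S => by
    rintro _ ⟨r, -, rfl⟩
    exact hA r
  have hfin : ∀ S, (A '' S).Finite := fun S => Sig.finite_toSet.subset (hsub S)
  induction hc : (A '' S).ncard using Nat.strong_induction_on generalizing S with
  | _ c ih =>
  rw [contProd]
  split_ifs with hS htop hpart
  · refine tendsto_const_nhds.congr' ?_
    filter_upwards [eventually_ge_atTop hS.toFinset] with F hF
    unfold partialWord
    congr 3
    ext x
    simp only [Set.Finite.mem_toFinset, Finset.mem_filter]
    exact ⟨fun hx => ⟨hF (hS.mem_toFinset.2 hx), hx⟩, fun hx => hx.2⟩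
  · have hP := isFixProj_projMatrix (hSig.transversal _ (hsub S))
    have hconv := hSig.rcp.rightConvergent
    obtain ⟨K, hK0, hK⟩ := hconv.exists_norm_prod_le
    refine Metric.tendsto_atTop.2 fun ε hε => ?_
    obtain ⟨k, hk⟩ := hconv.exists_norm_prod_sub_le (hsub S) hP
      (ε := ε / (2 * K)) (by positivity)
    -- Finitely many points witness `k` blocks, and every larger `F` retains them.
    obtain ⟨F₀, hF₀, hB⟩ := (hasBlocks_of_completeCount_eq_top (hfin S)
      (Set.Infinite.nonempty hS) htop k).exists_finset (hfin S)
    refine ⟨F₀, fun F hF => ?_⟩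
    obtain ⟨bs, r, he, hlen, hbs, hr⟩ := HasBlocks.exists_eq_flatten_append
      (hB.mono (T := S ∩ F) fun x hx => ⟨hF₀ hx, hF hx⟩) subset_rfl
    -- The letters after the `k` blocks are absorbed by the projection, so they only multiply the
    -- error by a factor of norm at most `K`.
    have h1 : (partialWord A S F).prod - projMatrix (A '' S) =
        (bs.flatten.prod - projMatrix (A '' S)) * r.prod := by
      rw [he, List.prod_append, sub_mul, hP.mul_prod hr]
    rw [dist_eq_norm, h1]
    calc _ ≤ ε / (2 * K) * K := (norm_mul_le _ _).trans
          (mul_le_mul (hk bs hbs hlen.ge) (hK r fun B hB => hsub S (hr B hB)) (norm_nonneg _)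
            (by positivity))
      _ = ε / 2 := by field_simp
      _ < ε := half_lt_self hε
  -- The limit does not see which partition was chosen: any increasing partition factors every
  -- finite product.
  · have hl := hpart.2.choose_spec
    generalize hpart.2.choose = l at hl
    have h1 := tendsto_list_prod (f := fun T F => (partialWord A T F).prod)
      (x := (atTop : Filter (Finset R))) (a := contProd A) l fun T hT => by
        refine ih _ ?_ T rfl
        rw [← hc]
        exact Set.ncard_lt_ncard (lt_of_le_of_ne (Set.image_mono (hl.interval T hT).1)
          (hl.incomplete T hT)) (hfin S)
    rw [List.attach_map_val (f := contProd A)]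
    refine h1.congr fun F => (partialWord_of_pairwise F l hl.increasing fun x => ?_).symm
    exact ⟨hl.cover x, fun ⟨T, hT, hx⟩ => (hl.interval T hT).1 hx⟩
  · exact absurd ⟨hfin S, exists_isIncompletePartition (hfin S) hS htop⟩ hpart

/-- The finite-word bounds are independent of `F`, so they survive the limit along finite sets; `C₁`
comes from RCP and serves lower sets, `C₂` from LCP and serves upper sets. -/
theorem exists_sum_norm_contProd_le {Sig : Finset (Matrix (Fin n) (Fin n) ℝ)}
    (hSig : IsCP (Sig : Set (Matrix (Fin n) (Fin n) ℝ))) {A : R → Matrix (Fin n) (Fin n) ℝ}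
    (hA : ∀ r, A r ∈ Sig) : ∃ C : ℝ, ∀ D : ℕ → Set R,
      (Monotone D ∧ (∀ i, IsLowerSet (D i))) ∨ (Antitone D ∧ (∀ i, IsUpperSet (D i))) →
      ∀ m : ℕ, ∑ i ∈ Finset.range m, ‖contProd A (D (i + 1)) - contProd A (D i)‖ ≤ C := by
  obtain ⟨C₁, hC₁⟩ := hSig.rcp.rightConvergent.exists_prodVariation_le fun J hJ =>
    ⟨_, isFixProj_projMatrix (hSig.transversal J hJ)⟩
  obtain ⟨C₂, hC₂⟩ := hSig.lcp.rightConvergent_op.exists_prodVariation_le fun J hJ => by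
    refine ⟨_, isFixProj_op_projMatrix (T := MulOpposite.op ⁻¹' J)
      (hSig.transversal _ fun B hB => ?_)⟩
    simpa using hJ hB
  have hword : ∀ S F, ∀ B ∈ partialWord A S F, B ∈ Sig := fun S F B hB => by
    obtain ⟨x, -, -, rfl⟩ := mem_partialWord.1 hB
    exact hA x
  refine ⟨max C₁ C₂, fun D hD m => ?_⟩
  refine le_of_tendsto' (tendsto_finsetSum _ fun i _ =>
    ((tendsto_prod_partialWord hSig hA (D (i + 1))).sub
      (tendsto_prod_partialWord hSig hA (D i))).norm) fun F => ?_
  rcases hD with ⟨hD, hlow⟩ | ⟨hD, hup⟩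
  · exact ((prodVariation_partialWord_lower hD hlow F m).trans (hC₁ _ (hword _ F))).trans
      (le_max_left _ _)
  · refine le_trans ?_ (le_max_right C₁ C₂)
    refine (le_add_of_nonneg_right (prodVariation_nonneg _ _)).trans
      ((prodVariation_partialWord_upper hD hup F m).trans (hC₂ _ fun B hB => ?_))
    obtain ⟨B', hB', rfl⟩ := List.mem_map.1 (List.mem_reverse.1 hB)
    simpa using hword _ F B' hB'

end Convergence

theorem boundedVariationOn_contProd {Sig : Finset (Matrix (Fin n) (Fin n) ℝ)}
    (hSig : IsCP (Sig : Set (Matrix (Fin n) (Fin n) ℝ))) {A : R → Matrix (Fin n) (Fin n) ℝ}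
    (hA : ∀ r, A r ∈ Sig) {D : R → Set R}
    (hD : (Monotone D ∧ (∀ r, IsLowerSet (D r))) ∨ (Antitone D ∧ (∀ r, IsUpperSet (D r)))) :
    BoundedVariationOn (fun r => contProd A (D r)) Set.univ := by
  obtain ⟨C, hC⟩ := exists_sum_norm_contProd_le hSig hA
  refine ne_top_of_le_ne_top (ENNReal.ofReal_ne_top (r := C)) (iSup_le fun p => ?_)
  have hu := p.2.2.1
  have h1 := hC (fun i => D (p.2.1 i))
    (hD.imp (fun h => ⟨h.1.comp hu, fun i => h.2 _⟩) fun h => ⟨h.1.comp_monotone hu, fun i => h.2 _⟩)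
    p.1
  refine le_trans (le_of_eq ?_) (ENNReal.ofReal_le_ofReal h1)
  rw [ENNReal.ofReal_sum_of_nonneg fun _ _ => norm_nonneg _]
  refine Finset.sum_congr rfl fun i _ => ?_
  rw [edist_dist, dist_eq_norm]

end Limit

theorem theorem4p4 {n : ℕ} (Sig : Finset (Matrix (Fin n) (Fin n) ℝ))
    (hSig : IsCP (Sig : Set (Matrix (Fin n) (Fin n) ℝ)))
    {R : Type*} [LinearOrder R] (A : R → Matrix (Fin n) (Fin n) ℝ) (hA : ∀ r, A r ∈ Sig) :
    BoundedVariationOn (fun r : R => contProd A {p | p ≤ r}) Set.univ ∧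
    BoundedVariationOn (fun r : R => contProd A {p | p < r}) Set.univ ∧
    BoundedVariationOn (fun r : R => contProd A {p | p ≥ r}) Set.univ ∧
    BoundedVariationOn (fun r : R => contProd A {p | p > r}) Set.univ :=
  ⟨boundedVariationOn_contProd hSig hA (.inl ⟨fun _ _ h => Set.Iic_subset_Iic.2 h, isLowerSet_Iic⟩),
    boundedVariationOn_contProd hSig hA (.inl ⟨fun _ _ h => Set.Iio_subset_Iio h, isLowerSet_Iio⟩),
    boundedVariationOn_contProd hSig hA (.inr ⟨fun _ _ h => Set.Ici_subset_Ici.2 h, isUpperSet_Ici⟩),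
    boundedVariationOn_contProd hSig hA (.inr ⟨fun _ _ h => Set.Ioi_subset_Ioi h, isUpperSet_Ioi⟩)⟩
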